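/- Let $\mathcal G=(\mathcal V,\mathcal E)$ be a finite directed graph without self-loops, $\mathcal V=\{1,\dots,L\}$, and let $\mathcal R,\mathcal C\subseteq\mathcal V$ be the excited and the measured vertices. Let $\mathcal M=\{(G(q,\theta),R,C):\theta\in\Theta\}$ be the network model set in which the modules are parametrized independently: $G(\cdot,\theta)$ runs through all $L\times L$ matrices over $\mathbb R(q)$ with proper and stable entries (all poles in $|q|<1$) such that $G_{ji}\neq0$ if and only if $(i,j)\in\mathcal E$, and such that $(I-G)^{-1}$ exists and is proper and stable. Put $T=(I-G)^{-1}$. The model set is identifiable (from $T_{\mathcal C,\mathcal R}$) if for all $\theta_0,\theta_1\in\Theta$, $T_{\mathcal C,\mathcal R}(q,\theta_1)=T_{\mathcal C,\mathcal R}(q,\theta_0)$ implies $G(q,\theta_1)=G(q,\theta_0)$. Now regard the modules $G_{ji}$, $(i,j)\in\mathcal E$, as indeterminates, so that the entries of $T$ are rational functions of them. Let $\mathscr F$ consist of the entries $T_{\ell k}$, $\ell\in\mathcal C$, $k\in\mathcal R$, with $T_{\ell k}\ne0$ and $T_{\ell k}\neq1$ (the nonconstant entries, as positions of $T_{\mathcal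 C,\mathcal R}$). The rank $\mathrm{Rank}$ is taken over the field of these rational functions, and $\mathrm{Sprank}(A)$ is the highest rank of all real matrices with the same nonzero pattern as $A$. Start with $\hat T=T_{\mathcal C,\mathcal R}$ and the set $\mathscr F$, and repeat the following as long as there are $\bar{\mathcal C}\subseteq\mathcal C$ and $\bar{\mathcal R}\subseteq\mathcal R$ with $$\mathrm{Rank}(\hat T_{\bar{\mathcal C},\bar{\mathcal R}})<\mathrm{Sprank}(\hat T_{\bar{\mathcal C},\bar{\mathcal R}})=|\bar{\mathcal C}|=|\bar{\mathcal R}| :$$ choose such $\bar{\mathcal C},\bar{\mathcal R}$ and $j\in\bar{\mathcal C}$, $i\in\bar{\mathcal R}$ such that $T_{ji}$ belongs to the current set and is dependent on the other functions in it, that is, it can be obtained from them and real constants by additions, subtractions, multiplications and divisions; remove $T_{ji}$ from the set and replace the $(j,i)$ entry of $\hat T$ by $0$. (Such $j,i$ always exist.) Let $\hat{\mathscr F}$ be the set that remains when the procedure stops, for any choices made during the run. If $\mathcal M$ is identifiable, then $|\hat{\mathscr F}|\ge|\mathcal E|$; this holds even when equal rational functions at different positions are counted only once. -/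

import Mathlib

/-!
A network has vertex set `Fin L` and edge set `E`, where `(i, j) ∈ E` is the edge from `i` to `j`.
The module on this edge is the entry `G j i` of the network matrix. -/

noncomputable section

namespace NetId

/-! ### Transfer matrices and network models -/

/-- A rational function of `q` is proper: numerator degree at most the denominator degree. -/
def Proper (g : RatFunc ℝ) : Prop :=
  g.num.natDegree ≤ g.denom.natDegree

/-- A rational function of the shift `q` (`q⁻¹` is the delay) is stable:
all its poles lie in the open unit disc. -/
def Stable (g : RatFunc ℝ) : Prop :=
  ∀ z : ℂ, Polynomial.aeval z g.denom = 0 → ‖z‖ < 1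

/-- `T = (I - G)⁻¹`. -/
def transfer {L : ℕ} {K : Type*} [Field K] (G : Matrix (Fin L) (Fin L) K) :
    Matrix (Fin L) (Fin L) K :=
  (1 - G)⁻¹

/-- The submatrix with rows in `C` and columns in `R`. -/
def sub {L : ℕ} {K : Type*} (A : Matrix (Fin L) (Fin L) K) (C R : Finset (Fin L)) :
    Matrix C R K :=
  A.submatrix (fun j => (j : Fin L)) (fun i => (i : Fin L))

/-- The network matrices on the graph with edge set `E`: the nonzero entries are exactly those on
edges, they are proper and stable, and the network is well-posed and stable. -/
structure IsNetwork {L : ℕ} (E : Finset (Fin L × Fin L))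
    (G : Matrix (Fin L) (Fin L) (RatFunc ℝ)) : Prop where
  ne_zero_iff : ∀ i j, G j i ≠ 0 ↔ (i, j) ∈ E
  proper : ∀ i j, Proper (G i j)
  stable : ∀ i j, Stable (G i j)
  wellPosed : IsUnit (1 - G).det
  transfer_proper : ∀ i j, Proper (transfer G i j)
  transfer_stable : ∀ i j, Stable (transfer G i j)

/-- `G : Θ → _` is a parametrization of the network model set of the graph with edge set `E`, whose
modules are independent: the models `G θ` are exactly the network matrices on that graph. -/
def IsModelSet {L : ℕ} (E : Finset (Fin L × Fin L)) {Θ : Type*}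
    (G : Θ → Matrix (Fin L) (Fin L) (RatFunc ℝ)) : Prop :=
  Set.range G = {A | IsNetwork E A}

/-- The model set is identifiable from `T_{C,R}`. -/
def Identifiable {L : ℕ} {Θ : Type*} (G : Θ → Matrix (Fin L) (Fin L) (RatFunc ℝ))
    (C R : Finset (Fin L)) : Prop :=
  ∀ θ₀ θ₁ : Θ, sub (transfer (G θ₁)) C R = sub (transfer (G θ₀)) C R → G θ₁ = G θ₀

/-! ### The entries of `T` as rational functions of the modules -/

/-- Rational functions with one indeterminate for each module (edge). -/
abbrev ModuleField {L : ℕ} (E : Finset (Fin L × Fin L)) : Type :=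
  FractionRing (MvPolynomial E ℝ)

/-- The matrix `G` with polynomial entries, the modules being indeterminates. -/
def polyG {L : ℕ} (E : Finset (Fin L × Fin L)) :
    Matrix (Fin L) (Fin L) (MvPolynomial E ℝ) :=
  fun j i => if h : (i, j) ∈ E then MvPolynomial.X ⟨(i, j), h⟩ else 0

/-- The matrix `T = (I - G)⁻¹`, the modules being indeterminates. -/
def symT {L : ℕ} (E : Finset (Fin L × Fin L)) : Matrix (Fin L) (Fin L) (ModuleField E) :=
  transfer ((polyG E).map (algebraMap (MvPolynomial E ℝ) (ModuleField E)))

/-- The positions `(ℓ, k)` of the nonconstant entries of `T_{C,R}`. -/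
def nonconstant {L : ℕ} (E : Finset (Fin L × Fin L)) (C R : Finset (Fin L)) :
    Finset (Fin L × Fin L) :=
  open Classical in
  (C ×ˢ R).filter fun p => symT E p.1 p.2 ≠ 0 ∧ symT E p.1 p.2 ≠ 1

/-- The set of rational functions found at the positions in `S`. -/
def functionsAt {L : ℕ} (E S : Finset (Fin L × Fin L)) : Set (ModuleField E) :=
  {f | ∃ p ∈ S, f = symT E p.1 p.2}

/-- The structural rank: the highest rank of the (real) matrices with the same nonzero pattern. -/
def sprank {m n K : Type*} [Fintype n] [Zero K] (A : Matrix m n K) : ℕ :=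
  sSup {r | ∃ B : Matrix m n ℝ, (∀ i j, B i j = 0 ↔ A i j = 0) ∧ B.rank = r}

/-! ### The elimination algorithm

A state is the set `S` of the positions of the nonconstant entries not removed so far. -/

/-- The matrix `T̂`: the nonconstant entries whose positions are not in `S` are set to zero. -/
def sparsified {L : ℕ} (E S : Finset (Fin L × Fin L)) :
    Matrix (Fin L) (Fin L) (ModuleField E) :=
  open Classical in
  fun j i => if symT E j i = 1 ∨ (j, i) ∈ S then symT E j i else 0

/-- The loop test for `C'`, `R'`: `Rank T̂_{C',R'} < Sprank T̂_{C',R'} = |C'| = |R'|`. -/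
def RankDeficient {L : ℕ} (E S : Finset (Fin L × Fin L)) (C' R' : Finset (Fin L)) : Prop :=
  (sub (sparsified E S) C' R').rank < sprank (sub (sparsified E S) C' R') ∧
    sprank (sub (sparsified E S) C' R') = C'.card ∧ C'.card = R'.card

/-- The function at position `p` is dependent on the other functions of the current set: it is
obtained from them (and real numbers) by additions, subtractions, multiplications, divisions. -/
def Dependent {L : ℕ} (E S : Finset (Fin L × Fin L)) (p : Fin L × Fin L) : Prop :=
  symT E p.1 p.2 ∈ IntermediateField.adjoin ℝ (functionsAt E (S.erase p))

/-- One iteration: find `C' ⊆ C`, `R' ⊆ R` that pass the loop test, select `j ∈ C'`, `i ∈ R'`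
such that the `(j, i)` entry is in the current set and is dependent on the others, remove it. -/
def Step {L : ℕ} (E : Finset (Fin L × Fin L)) (C R : Finset (Fin L))
    (S S' : Finset (Fin L × Fin L)) : Prop :=
  ∃ C' ⊆ C, ∃ R' ⊆ R, RankDeficient E S C' R' ∧
    ∃ j ∈ C', ∃ i ∈ R', (j, i) ∈ S ∧ Dependent E S (j, i) ∧ S' = S.erase (j, i)

/-- `S` is returned by a run of the algorithm: it is reached from the set of all nonconstant
entries by finitely many iterations, and no `C' ⊆ C`, `R' ⊆ R` pass the loop test any more. -/
def IsOutput {L : ℕ} (E : Finset (Fin L × Fin L)) (C R : Finset (Fin L))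
    (S : Finset (Fin L × Fin L)) : Prop :=
  Relation.ReflTransGen (Step E C R) (nonconstant E C R) S ∧
    ∀ C' ⊆ C, ∀ R' ⊆ R, ¬ RankDeficient E S C' R'

/-! ### The algorithm never gets stuck

Whenever `C'`, `R'` pass the loop test, an entry as required by `Step` exists, for those very `C'`
and `R'`. Hence every run ends with an output. -/

theorem exists_solvable_entry {K : Type*} [Field K] (k : ℕ) (A : Matrix (Fin k) (Fin k) K)
    (hone : ∀ a b b', A a b = 1 → A a b' = 1 → b = b')
    (f : Fin k → Fin k) (hf : Function.Injective f) (hA : ∀ a, A a (f a) ≠ 0)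
    (hdet : A.det = 0) :
    ∃ a b, A a b ≠ 0 ∧ A a b ≠ 1 ∧ ∀ F : Subfield K,
      (∀ a' b', (a', b') ≠ (a, b) → A a' b' ∈ F) → A a b ∈ F := by
  induction k with
  | zero => simp at hdet
  | succ k ih =>
    -- a transversal with an entry other than 1
    obtain ⟨f, hf, hA, a, ha⟩ : ∃ f : Fin (k + 1) → Fin (k + 1), Function.Injective f ∧
        (∀ a, A a (f a) ≠ 0) ∧ ∃ a, A a (f a) ≠ 1 := by
      by_contra! hcon
      have h1 := hcon f hf hA
      let σ : Equiv.Perm (Fin (k + 1)) :=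
        Equiv.ofBijective f (Finite.injective_iff_bijective.1 hf)
      have key : A.transpose.det = Equiv.Perm.sign σ := by
        rw [Matrix.det_apply, Finset.sum_eq_single σ]
        · have : ∏ i, A.transpose (σ i) i = 1 :=
            Finset.prod_eq_one fun i _ => h1 i
          rw [this]
          simp [Units.smul_def]
        · intro τ _ hτ
          by_cases hz : ∃ i, A i (τ i) = 0
          · obtain ⟨i, hi⟩ := hz
            rw [Finset.prod_eq_zero (Finset.mem_univ i) (by simpa using hi), smul_zero]
          · push Not at hz
            have h2 := hcon τ τ.injective hz
            exact absurd (Equiv.ext fun i => hone i _ _ (h2 i) (h1 i)) hτ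
        · simp
      rw [Matrix.det_transpose, hdet] at key
      rcases Int.units_eq_one_or (Equiv.Perm.sign σ) with h | h <;> simp [h] at key
    set b := f a with hb
    have hex : ∀ i, ∃ j, b.succAbove j = f (a.succAbove i) := fun i =>
      Fin.exists_succAbove_eq fun h => Fin.succAbove_ne a i (hf h)
    choose g hg using hex
    have hg_inj : Function.Injective g := fun i i' h =>
      Fin.succAbove_right_injective (hf (by rw [← hg, ← hg, h]))
    by_cases hm : (A.submatrix a.succAbove b.succAbove).det = 0
    · obtain ⟨c, d, h0, h1, hF⟩ := ih (A.submatrix a.succAbove b.succAbove)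
        (fun x y y' h h' => Fin.succAbove_right_injective (hone _ _ _ h h'))
        g hg_inj (fun x => by simpa [hg] using hA (a.succAbove x)) hm
      refine ⟨a.succAbove c, b.succAbove d, h0, h1, fun F h => hF F fun a' b' hne => h _ _ ?_⟩
      intro h
      simp only [Prod.mk.injEq, Fin.succAbove_right_inj] at h
      exact hne (by rw [h.1, h.2])
    · refine ⟨a, b, hA a, ha, fun F h => ?_⟩
      have hminor : (A.submatrix a.succAbove b.succAbove).det ∈ F := by
        rw [Matrix.det_apply]
        refine F.sum_mem fun τ _ => ?_
        rw [Units.smul_def]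
        refine zsmul_mem (F.prod_mem fun i _ => h _ _ ?_) _
        intro h'
        exact Fin.succAbove_ne _ _ (Prod.ext_iff.1 h').1
      have hexp := Matrix.det_succ_row A a
      rw [hdet, ← Finset.add_sum_erase _ _ (Finset.mem_univ b)] at hexp
      set s : K := (-1) ^ (a + b : ℕ) with hs
      have hsF : s ∈ F := F.pow_mem (F.neg_mem F.one_mem) _
      have hs0 : s ≠ 0 := pow_ne_zero _ (by simp)
      set r := ∑ x ∈ Finset.univ.erase b,
        (-1) ^ (a + x : ℕ) * A a x * (A.submatrix a.succAbove x.succAbove).det with hr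
      have hrF : r ∈ F := by
        refine F.sum_mem fun x hx => F.mul_mem (F.mul_mem (F.pow_mem (F.neg_mem F.one_mem) _)
          (h _ _ ?_)) ?_
        · intro h'
          exact (Finset.mem_erase.1 hx).1 (Prod.ext_iff.1 h').2
        · rw [Matrix.det_apply]
          refine F.sum_mem fun τ _ => ?_
          rw [Units.smul_def]
          refine zsmul_mem (F.prod_mem fun i _ => h _ _ ?_) _
          intro h'
          exact Fin.succAbove_ne _ _ (Prod.ext_iff.1 h').1
      have : A a b = -r / (s * (A.submatrix a.succAbove b.succAbove).det) := by
        rw [eq_div_iff (mul_ne_zero hs0 hm)]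
        linear_combination -hexp
      rw [this]
      exact F.div_mem (F.neg_mem hrF) (F.mul_mem hsF hminor)

/-- Off-diagonal entries of `T` are never the constant 1 (their value at `G = 0` is 0). -/
theorem symT_ne_one {L : ℕ} (E : Finset (Fin L × Fin L)) {j i : Fin L} (h : j ≠ i) :
    symT E j i ≠ 1 := by
  intro h1
  set P : Matrix (Fin L) (Fin L) (MvPolynomial E ℝ) := 1 - polyG E with hP
  have hP0 : P.map (MvPolynomial.constantCoeff (R := ℝ) (σ := E)) = 1 := by
    ext a b
    have hz : MvPolynomial.constantCoeff (polyG E a b) = 0 := by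
      unfold polyG
      split_ifs <;> simp
    rw [Matrix.map_apply, hP, Matrix.sub_apply, map_sub, hz, sub_zero]
    by_cases hab : a = b <;> simp [hab, Matrix.one_apply]
  have hd : MvPolynomial.constantCoeff P.det = 1 := by
    rw [RingHom.map_det, RingHom.mapMatrix_apply, hP0, Matrix.det_one]
  have hadj : MvPolynomial.constantCoeff (P.adjugate j i) = 0 := by
    have := congrFun (congrFun
      ((MvPolynomial.constantCoeff (R := ℝ) (σ := E)).map_adjugate P) j) i
    simp only [RingHom.mapMatrix_apply, Matrix.map_apply] at this
    rw [this, hP0]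
    simp [h]
  have hmap : 1 - (polyG E).map (algebraMap (MvPolynomial E ℝ) (ModuleField E)) =
      (algebraMap (MvPolynomial E ℝ) (ModuleField E)).mapMatrix P := by
    rw [hP, map_sub, map_one, RingHom.mapMatrix_apply]
  have hdet0 : P.det ≠ 0 := by
    intro h0
    simp [h0] at hd
  have hinj := IsFractionRing.injective (MvPolynomial E ℝ) (ModuleField E)
  rw [symT, transfer, hmap, Matrix.inv_def, ← RingHom.map_det, ← RingHom.map_adjugate,
    Matrix.smul_apply, RingHom.mapMatrix_apply, Matrix.map_apply, Ring.inverse_eq_inv',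
    smul_eq_mul, inv_mul_eq_one₀ (by simpa using hdet0)] at h1
  rw [hinj h1, hadj] at hd
  exact zero_ne_one hd

theorem exists_dependent_entry {L : ℕ} (E S : Finset (Fin L × Fin L)) (C' R' : Finset (Fin L))
    (h : RankDeficient E S C' R') :
    ∃ j ∈ C', ∃ i ∈ R', (j, i) ∈ S ∧ Dependent E S (j, i) := by
  classical
  obtain ⟨hlt, hsp, hcard⟩ := h
  rw [hsp] at hlt
  set A := sub (sparsified E S) C' R' with hA
  set k := C'.card with hk
  obtain ⟨B, hB, hBr⟩ : ∃ B : Matrix C' R' ℝ, (∀ i j, B i j = 0 ↔ A i j = 0) ∧ B.rank = k := by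
    rw [← hsp]
    refine Nat.sSup_mem
      (s := {r | ∃ B : Matrix C' R' ℝ, (∀ i j, B i j = 0 ↔ A i j = 0) ∧ B.rank = r})
      ⟨_, fun a b => if A a b = 0 then 0 else 1, by simp, rfl⟩ ⟨Fintype.card R', ?_⟩
    rintro r ⟨B, -, rfl⟩
    exact B.rank_le_card_width
  let eC : Fin k ≃ C' := (C'.equivFinOfCardEq rfl).symm
  let eR : Fin k ≃ R' := (R'.equivFinOfCardEq hcard.symm).symm
  have hBdet : (B.submatrix eC eR).det ≠ 0 := by
    have hr : (B.submatrix eC eR).rank = k := by rw [Matrix.rank_submatrix, hBr]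
    intro h0
    have hu : ¬ LinearIndependent ℝ (B.submatrix eC eR).row := by
      rw [Matrix.linearIndependent_rows_iff_isUnit, Matrix.isUnit_iff_isUnit_det, h0]
      simp
    refine hu ?_
    rw [linearIndependent_iff_card_eq_finrank_span, Set.finrank, ← Matrix.rank_eq_finrank_span_row,
      hr, Fintype.card_fin]
  obtain ⟨σ, hσ⟩ : ∃ σ : Equiv.Perm (Fin k), ∀ i, B (eC (σ i)) (eR i) ≠ 0 := by
    by_contra! hcon
    refine hBdet ?_
    rw [Matrix.det_apply]
    refine Finset.sum_eq_zero fun σ _ => ?_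
    obtain ⟨i, hi⟩ := hcon σ
    rw [Finset.prod_eq_zero (Finset.mem_univ i) (by simpa using hi), smul_zero]
  have hAdet : (A.submatrix eC eR).det = 0 := by
    by_contra h0
    have hu : IsUnit (A.submatrix eC eR) := by
      rw [Matrix.isUnit_iff_isUnit_det]
      exact isUnit_iff_ne_zero.2 h0
    have := Matrix.rank_of_isUnit _ hu
    rw [Matrix.rank_submatrix, Fintype.card_fin] at this
    omega
  have hval : ∀ x y, A x y = 1 → (x : Fin L) = y := by
    intro x y hxy
    by_contra hne
    have h1 := symT_ne_one E hne
    simp only [hA, sub, sparsified, Matrix.submatrix_apply] at hxy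
    split_ifs at hxy
    · exact h1 hxy
    · exact zero_ne_one hxy
  obtain ⟨a, b, h0, h1, hF⟩ := exists_solvable_entry k (A.submatrix eC eR)
    (fun a b b' h h' => eR.injective (Subtype.ext ((hval _ _ h).symm.trans (hval _ _ h'))))
    (fun i => σ.symm i) σ.symm.injective
    (fun i => by
      have := hσ (σ.symm i)
      rw [Equiv.apply_symm_apply] at this
      exact fun h => this ((hB _ _).2 h)) hAdet
  have hab : A (eC a) (eR b) = symT E (eC a) (eR b) ∧ ((eC a : Fin L), (eR b : Fin L)) ∈ S := by
    have h0' : A (eC a) (eR b) ≠ 0 := h0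
    have h1' : A (eC a) (eR b) ≠ 1 := h1
    simp only [hA, sub, sparsified, Matrix.submatrix_apply] at h0' h1' ⊢
    split_ifs at h0' h1' ⊢ with hc
    · rcases hc with hc | hc
      · exact absurd hc h1'
      · exact ⟨rfl, hc⟩
    · exact absurd rfl h0'
  refine ⟨eC a, (eC a).2, eR b, (eR b).2, hab.2, ?_⟩
  rw [Dependent, ← hab.1]
  refine hF (IntermediateField.adjoin ℝ
    (functionsAt E (S.erase ((eC a : Fin L), (eR b : Fin L))))).toSubfield fun a' b' hne => ?_
  change A (eC a') (eR b') ∈ IntermediateField.adjoin ℝ _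
  simp only [hA, sub, sparsified, Matrix.submatrix_apply]
  split_ifs with hc
  · rcases hc with hc | hc
    · rw [hc]
      exact one_mem _
    · refine IntermediateField.subset_adjoin _ _ ⟨_, Finset.mem_erase.2 ⟨?_, hc⟩, rfl⟩
      intro h'
      rw [Prod.ext_iff] at h'
      exact hne (Prod.ext (eC.injective (Subtype.ext h'.1)) (eR.injective (Subtype.ext h'.2)))
  · exact zero_mem _

end NetId

end

noncomputable section

open MvPolynomial

/-! ### Rational functions annihilated by a derivation -/

/-! Count dimensions. If fewer than `E.card` distinct functions remain, their Jacobian with respect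
to the modules has a nontrivial kernel vector, that is, a nonzero polynomial vector field `v` whose
derivation kills all of them (`MvPolynomial.exists_ne_zero_subset_fractionConstants`). The functions
killed by a derivation form a field, and each removed entry is a rational expression in the others,
so the derivation kills every entry of $T_{\mathcal C,\mathcal R}$ (`symT_mem_adjoin_of_isOutput`).

These entries are therefore constant along the integral curves of `v`. Starting at a generic real
point, the curve reaches a second point with the same $T_{\mathcal C,\mathcal R}$
(`MvPolynomial.exists_ne_forall_eval_div_eval_eq`). Real constants are proper and stable modules, so
both points are networks of the model set (`isNetwork_map_C_eval`), which contradicts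
identifiability. -/

/-- The fractions `p / q` annihilated by (the extension to the fraction field of) a derivation
of a domain, as an intermediate field. -/
def Derivation.fractionConstants {k A : Type*} (K : Type*) [Field k] [CommRing A] [IsDomain A]
    [Algebra k A] [Field K] [Algebra A K] [IsFractionRing A K] [Algebra k K] [IsScalarTower k A K]
    (D : Derivation k A A) : IntermediateField k K where
  -- The last condition is the vanishing of the numerator in the quotient rule, so `D` need not be
  -- extended to `K`.
  carrier := {f | ∃ p q : A, q ≠ 0 ∧ f * algebraMap A K q = algebraMap A K p ∧
    q * D p = p * D q}
  mul_mem' := by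
    rintro f g ⟨p, q, hq, hf, hD⟩ ⟨p', q', hq', hg, hD'⟩
    refine ⟨p * p', q * q', mul_ne_zero hq hq', ?_, ?_⟩
    · rw [map_mul, map_mul, ← hf, ← hg]
      ring
    · simp only [Derivation.leibniz, smul_eq_mul]
      linear_combination q' * p' * hD + q * p * hD'
  add_mem' := by
    rintro f g ⟨p, q, hq, hf, hD⟩ ⟨p', q', hq', hg, hD'⟩
    refine ⟨p * q' + p' * q, q * q', mul_ne_zero hq hq', ?_, ?_⟩
    · rw [map_add, map_mul, map_mul, map_mul, ← hf, ← hg]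
      ring
    · simp only [map_add, Derivation.leibniz, smul_eq_mul]
      linear_combination q' * q' * hD + q * q * hD'
  algebraMap_mem' r := by
    refine ⟨algebraMap k A r, 1, one_ne_zero, ?_, ?_⟩
    · rw [map_one, mul_one, ← IsScalarTower.algebraMap_apply]
    · simp
  inv_mem' := by
    rintro f ⟨p, q, hq, hf, hD⟩
    rcases eq_or_ne p 0 with rfl | hp
    · have hq' : algebraMap A K q ≠ 0 := by simpa using hq
      have : f = 0 := by simpa [hq'] using hf
      exact ⟨0, 1, one_ne_zero, by simp [this], by simp⟩
    · refine ⟨q, p, hp, ?_, hD.symm⟩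
      have hp' : algebraMap A K p ≠ 0 := by simpa using hp
      have hf0 : f ≠ 0 := by
        rintro rfl
        exact hp' (by rw [← hf, zero_mul])
      rw [← hf, inv_mul_cancel_left₀ hf0]

/-- Membership only provides some representation `p / q`. Differentiating `a * q = p * b` carries
the identity over to any other one, in particular to the denominator `det (1 - G)` shared by all
entries of `T`. -/
theorem Derivation.mul_eq_mul_of_mem_fractionConstants {k A K : Type*} [Field k] [CommRing A]
    [IsDomain A] [Algebra k A] [Field K] [Algebra A K] [IsFractionRing A K] [Algebra k K]
    [IsScalarTower k A K] (D : Derivation k A A) {a b : A} (hb : b ≠ 0)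
    (h : algebraMap A K a / algebraMap A K b ∈ D.fractionConstants K) : b * D a = a * D b := by
  obtain ⟨p, q, hq, hf, hD⟩ := h
  have hb' : algebraMap A K b ≠ 0 := by simpa using hb
  have hpq : a * q = p * b := by
    apply IsFractionRing.injective A K
    rw [map_mul, map_mul, ← hf]
    field_simp
  have hDpq : D (a * q) = D (p * b) := by rw [hpq]
  simp only [Derivation.leibniz, smul_eq_mul] at hDpq
  refine mul_left_cancel₀ (mul_ne_zero hq hq) ?_
  linear_combination q * b * hDpq + b * b * hD - (b * D q + q * D b) * hpq

/-- Fewer rational functions than indeterminates are annihilated by a common nonzero derivation. -/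
theorem MvPolynomial.exists_ne_zero_subset_fractionConstants {σ k : Type*} [Fintype σ] [Field k]
    (s : Set (FractionRing (MvPolynomial σ k))) (hs : s.Finite) (hcard : s.ncard < Fintype.card σ) :
    ∃ v : σ → MvPolynomial σ k, v ≠ 0 ∧
      s ⊆ (mkDerivation k v).fractionConstants (FractionRing (MvPolynomial σ k)) := by
  classical
  have := hs.fintype
  choose p q hq hpq using fun f : s =>
    IsFractionRing.div_surjective (A := MvPolynomial σ k) (f : FractionRing (MvPolynomial σ k))
  -- The Jacobian of the functions in `s`, each row scaled by the squared denominator. It has fewer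
  -- rows than columns, so it has a kernel vector already over the polynomial ring.
  let M : Matrix s σ (MvPolynomial σ k) := fun f e =>
    q f * pderiv e (p f) - p f * pderiv e (q f)
  obtain ⟨v, hv, hv0⟩ : ∃ v, M.mulVecLin v = 0 ∧ v ≠ 0 := by
    by_contra! hcon
    have h := card_le_of_injective (MvPolynomial σ k) M.mulVecLin
      ((injective_iff_map_eq_zero _).2 hcon)
    rw [← Nat.card_eq_fintype_card (α := s), Nat.card_coe_set_eq] at h
    omega
  refine ⟨v, hv0, fun f hf => ⟨p ⟨f, hf⟩, q ⟨f, hf⟩, nonZeroDivisors.ne_zero (hq _), ?_, ?_⟩⟩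
  · have hq0 : algebraMap (MvPolynomial σ k) (FractionRing (MvPolynomial σ k)) (q ⟨f, hf⟩) ≠ 0 := by
      simpa using nonZeroDivisors.ne_zero (hq ⟨f, hf⟩)
    exact ((div_eq_iff hq0).1 (hpq ⟨f, hf⟩)).symm
  · have hD : mkDerivation k v = ∑ e, v e • pderiv (R := k) e := by
      refine derivation_ext fun i => ?_
      have : (∑ e, v e • pderiv (R := k) e) (X i) = ∑ e, v e * pderiv (R := k) e (X i) := by
        rw [← Derivation.coeFnAddMonoidHom_apply, map_sum, Finset.sum_apply]
        rfl
      rw [this, mkDerivation_X, Finset.sum_eq_single i]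
      · simp
      · intro j _ hj
        rw [pderiv_X_of_ne hj.symm, mul_zero]
      · simp
    have hsum : ∀ a : MvPolynomial σ k, mkDerivation k v a = ∑ e, v e * pderiv e a := by
      intro a
      rw [hD, ← Derivation.coeFnAddMonoidHom_apply, map_sum, Finset.sum_apply]
      rfl
    have h0 := congrFun hv ⟨f, hf⟩
    rw [Matrix.mulVecLin_apply, Matrix.mulVec, dotProduct, Pi.zero_apply] at h0
    rw [hsum, hsum, ← sub_eq_zero, ← h0, Finset.mul_sum, Finset.mul_sum, ← Finset.sum_sub_distrib]
    refine Finset.sum_congr rfl fun e _ => ?_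
    simp only [M]
    ring

/-! ### Integral curves of polynomial vector fields -/

theorem MvPolynomial.hasDerivAt_eval_comp {σ : Type*} [Fintype σ] (v : σ → MvPolynomial σ ℝ)
    {x : ℝ → σ → ℝ} {t : ℝ} (hx : HasDerivAt x (fun e => eval (x t) (v e)) t)
    (p : MvPolynomial σ ℝ) :
    HasDerivAt (fun s => eval (x s) p) (eval (x t) (mkDerivation ℝ v p)) t := by
  induction p using MvPolynomial.induction_on with
  | C a => simpa using hasDerivAt_const t a
  | add p q hp hq => simpa using hp.fun_add hq
  | mul_X p i hp =>
    have hi : HasDerivAt (fun s => x s i) (eval (x t) (v i)) t := hasDerivAt_pi.1 hx i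
    simp only [map_mul, eval_X, Derivation.leibniz, mkDerivation_X, smul_eq_mul, map_add]
    convert! hp.fun_mul hi using 1
    ring

/-- At a point where a polynomial vector field and a polynomial `d` do not vanish, there is
another point nearby at which all first integrals `a / d` of the vector field have the same
values. -/
theorem MvPolynomial.exists_ne_forall_eval_div_eval_eq {σ : Type*} [Fintype σ]
    (v : σ → MvPolynomial σ ℝ) (x₀ : σ → ℝ) {e : σ} (he : eval x₀ (v e) ≠ 0)
    {d : MvPolynomial σ ℝ} (U : Set (σ → ℝ)) (hU : IsOpen U) (hx₀ : x₀ ∈ U)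
    (hd : ∀ x ∈ U, eval x d ≠ 0) :
    ∃ x₁ ∈ U, x₁ ≠ x₀ ∧ ∀ a : MvPolynomial σ ℝ,
      d * mkDerivation ℝ v a = a * mkDerivation ℝ v d →
        eval x₁ a / eval x₁ d = eval x₀ a / eval x₀ d := by
  -- Smoothness of the vector field gives a local integral curve through `x₀` by Picard–Lindelöf.
  have hv : ContDiffAt ℝ 1 (fun x (e : σ) => eval x (v e)) x₀ :=
    contDiffAt_pi.2 fun e => (AnalyticOnNhd.eval_mvPolynomial (v e) x₀ trivial).contDiffAt
  obtain ⟨x, rfl, ε, hε, hx⟩ :=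
    hv.exists_forall_mem_closedBall_exists_eq_forall_mem_Ioo_hasDerivAt₀ 0
  have hx0 := hx 0 (by simpa using hε)
  obtain ⟨δ, hδ, hδU⟩ := Metric.mem_nhds_iff.1 (hx0.continuousAt (hU.mem_nhds hx₀))
  -- The initial velocity is nonzero in coordinate `e`, so the curve leaves its starting point at
  -- once.
  have hne : ∀ᶠ t in nhdsWithin 0 {0}ᶜ, x t ≠ x 0 := by
    refine hx0.eventually_ne fun h => he (congrFun h e)
  have hball : ∀ᶠ t : ℝ in nhdsWithin 0 {0}ᶜ, t ∈ Metric.ball 0 (min ε δ) :=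
    mem_nhdsWithin_of_mem_nhds (Metric.ball_mem_nhds _ (lt_min hε hδ))
  obtain ⟨t, hxt, ht⟩ := (hne.and hball).exists
  have hmem : ∀ s ∈ Metric.ball (0 : ℝ) (min ε δ), x s ∈ U := fun s hs =>
    hδU (Metric.ball_subset_ball (min_le_right _ _) hs)
  refine ⟨x t, hmem t ht, hxt, fun a ha => ?_⟩
  -- By the quotient rule, the identity `ha` evaluated on the curve says that `a / d` has derivative
  -- zero.
  have hderiv : ∀ s ∈ Metric.ball (0 : ℝ) (min ε δ),
      HasDerivAt (fun s => eval (x s) a / eval (x s) d) 0 s := by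
    intro s hs
    have hs' : s ∈ Set.Ioo (0 - ε) (0 + ε) := by
      rw [← Real.ball_eq_Ioo]
      exact Metric.ball_subset_ball (min_le_left _ _) hs
    convert! (hasDerivAt_eval_comp v (hx s hs') a).fun_div
      (hasDerivAt_eval_comp v (hx s hs') d) (hd _ (hmem s hs)) using 1
    have := congrArg (eval (x s)) ha
    simp only [map_mul] at this
    rw [eq_comm, div_eq_zero_iff]
    left
    linear_combination this
  exact Metric.isOpen_ball.is_const_of_deriv_eq_zero
    (convex_ball (0 : ℝ) (min ε δ)).isPreconnected
    (fun s hs => (hderiv s hs).differentiableAt.differentiableWithinAt)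
    (fun s hs => (hderiv s hs).deriv) ht (Metric.mem_ball_self (lt_min hε hδ))

namespace NetId

/-! ### Transfer matrices -/

/-- Cramer's rule before applying `f`: the same adjugate and determinant serve the symbolic `T` and
its values at real points. If `f` kills the determinant, both sides are 0 by convention. -/
theorem transfer_map_apply {L : ℕ} {A K : Type*} [CommRing A] [Field K] (f : A →+* K)
    (M : Matrix (Fin L) (Fin L) A) (l k : Fin L) :
    transfer (M.map f) l k = f ((1 - M).adjugate l k) / f (1 - M).det := by
  have hmap : 1 - M.map f = f.mapMatrix (1 - M) := by
    rw [map_sub, map_one, RingHom.mapMatrix_apply]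
  rw [transfer, hmap, Matrix.inv_def, ← RingHom.map_det, ← RingHom.map_adjugate,
    Matrix.smul_apply, RingHom.mapMatrix_apply, Matrix.map_apply, Ring.inverse_eq_inv',
    smul_eq_mul, div_eq_inv_mul]

/-- Setting all modules to 0 turns the matrix into the identity. -/
theorem det_one_sub_polyG_ne_zero {L : ℕ} (E : Finset (Fin L × Fin L)) :
    (1 - polyG E).det ≠ 0 := by
  intro h
  have h0 : (1 - polyG E).map (constantCoeff (R := ℝ) (σ := E)) = 1 := by
    ext a b
    have hz : constantCoeff (polyG E a b) = 0 := by
      unfold polyG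
      split_ifs <;> simp
    rw [Matrix.map_apply, Matrix.sub_apply, map_sub, hz, sub_zero]
    by_cases hab : a = b <;> simp [hab, Matrix.one_apply]
  have hd : constantCoeff (1 - polyG E).det = 1 := by
    rw [RingHom.map_det, RingHom.mapMatrix_apply, h0, Matrix.det_one]
  simp [h] at hd

/-- Real nonzero values of the modules give a network matrix, when the network is well-posed. -/
theorem isNetwork_map_C_eval {L : ℕ} (E : Finset (Fin L × Fin L)) (x : E → ℝ)
    (hx : ∀ e, x e ≠ 0) (hdet : eval x (1 - polyG E).det ≠ 0) :
    IsNetwork E ((polyG E).map (RatFunc.C.comp (eval x))) := by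
  have hproper : ∀ r : ℝ, Proper (RatFunc.C r) := fun r => by simp [Proper]
  have hstable : ∀ r : ℝ, Stable (RatFunc.C r) := fun r z hz => by simp at hz
  -- The closed-loop entries are real constants too, hence proper and without poles.
  have htransfer : ∀ i j, transfer ((polyG E).map (RatFunc.C.comp (eval x))) i j =
      RatFunc.C (eval x ((1 - polyG E).adjugate i j) / eval x (1 - polyG E).det) := fun i j => by
    rw [transfer_map_apply, map_div₀, RingHom.comp_apply, RingHom.comp_apply]
  refine ⟨fun i j => ?_, fun i j => hproper _, fun i j => hstable _, ?_, fun i j => ?_,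
    fun i j => ?_⟩
  · by_cases h : (i, j) ∈ E
    · simp [polyG, h, hx]
    · simp [polyG, h]
  · have hmap : 1 - (polyG E).map (RatFunc.C.comp (eval x)) =
        (RatFunc.C.comp (eval x)).mapMatrix (1 - polyG E) := by
      rw [map_sub, map_one, RingHom.mapMatrix_apply]
    rw [hmap, ← RingHom.map_det, RingHom.comp_apply, isUnit_iff_ne_zero]
    simpa using hdet
  · rw [htransfer]
    exact hproper _
  · rw [htransfer]
    exact hstable _

/-! ### The elimination algorithm -/

theorem finite_functionsAt {L : ℕ} (E S : Finset (Fin L × Fin L)) : (functionsAt E S).Finite := by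
  refine (S.finite_toSet.image fun p => symT E p.1 p.2).subset ?_
  rintro f ⟨p, hp, rfl⟩
  exact ⟨p, hp, rfl⟩

/-- The removed function lies in the field generated by the rest, so a removal loses nothing from
the generated field. -/
theorem adjoin_functionsAt_le_of_step {L : ℕ} {E : Finset (Fin L × Fin L)} {C R : Finset (Fin L)}
    {S S' : Finset (Fin L × Fin L)} (h : Step E C R S S') :
    IntermediateField.adjoin ℝ (functionsAt E S) ≤
      IntermediateField.adjoin ℝ (functionsAt E S') := by
  obtain ⟨-, -, -, -, -, j, -, i, -, -, hdep, rfl⟩ := h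
  rw [IntermediateField.adjoin_le_iff]
  rintro f ⟨p, hp, rfl⟩
  by_cases hpi : p = (j, i)
  · subst hpi
    exact hdep
  · exact IntermediateField.subset_adjoin _ _ ⟨p, Finset.mem_erase.2 ⟨hpi, hp⟩, rfl⟩

theorem symT_mem_adjoin_of_isOutput {L : ℕ} {E : Finset (Fin L × Fin L)} {C R : Finset (Fin L)}
    {F : Finset (Fin L × Fin L)} (hF : IsOutput E C R F) {l k : Fin L} (hl : l ∈ C) (hk : k ∈ R) :
    symT E l k ∈ IntermediateField.adjoin ℝ (functionsAt E F) := by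
  have hle : IntermediateField.adjoin ℝ (functionsAt E (nonconstant E C R)) ≤
      IntermediateField.adjoin ℝ (functionsAt E F) := by
    obtain ⟨hrun, -⟩ := hF
    induction hrun with
    | refl => exact le_rfl
    | tail _ hstep ih => exact ih.trans (adjoin_functionsAt_le_of_step hstep)
  by_cases h0 : symT E l k = 0
  · rw [h0]
    exact zero_mem _
  by_cases h1 : symT E l k = 1
  · rw [h1]
    exact one_mem _
  refine hle (IntermediateField.subset_adjoin _ _ ⟨(l, k), ?_, rfl⟩)
  classical
  rw [nonconstant, Finset.mem_filter]
  exact ⟨Finset.mem_product.2 ⟨hl, hk⟩, h0, h1⟩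

end NetId

end

/-! ### Two networks with the same measured transfer matrix -/

theorem theorem1 (L : ℕ) (E : Finset (Fin L × Fin L)) (hE : ∀ i : Fin L, (i, i) ∉ E)
    (R C : Finset (Fin L))
    {Θ : Type*} (G : Θ → Matrix (Fin L) (Fin L) (RatFunc ℝ)) (hG : NetId.IsModelSet E G)
    (hid : NetId.Identifiable G C R)
    (F : Finset (Fin L × Fin L)) (hF : NetId.IsOutput E C R F) :
    E.card ≤ (NetId.functionsAt E F).ncard := by
  by_contra! hlt
  obtain ⟨v, hv, hvF⟩ := MvPolynomial.exists_ne_zero_subset_fractionConstants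
    (NetId.functionsAt E F) (NetId.finite_functionsAt E F) (by simpa using hlt)
  have hconst := IntermediateField.adjoin_le_iff.2 hvF
  set d := (1 - NetId.polyG E).det with hd
  have hd0 : d ≠ 0 := NetId.det_one_sub_polyG_ne_zero E
  obtain ⟨e, he⟩ := Function.ne_iff.1 hv
  -- The three factors ensure that the curve moves in coordinate `e`, that the network is
  -- well-posed, and that no module on an edge vanishes. Their product is a nonzero polynomial over
  -- an infinite field.
  obtain ⟨x₀, hx₀⟩ : ∃ x₀, MvPolynomial.eval x₀ (v e * d * ∏ e : E, MvPolynomial.X e) ≠ 0 := by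
    by_contra! hcon
    refine mul_ne_zero (mul_ne_zero he hd0)
      (Finset.prod_ne_zero_iff.2 fun (e : E) (_ : e ∈ Finset.univ) =>
        MvPolynomial.X_ne_zero e)
      (MvPolynomial.funext fun x => ?_)
    rw [hcon, map_zero]
  simp only [map_mul, map_prod, MvPolynomial.eval_X, mul_ne_zero_iff, Finset.prod_ne_zero_iff,
    Finset.mem_univ, true_imp_iff] at hx₀
  -- Well-posedness and nonzero modules are open conditions, so they persist at a nearby point of
  -- the curve.
  have hopen : IsOpen {x : E → ℝ | MvPolynomial.eval x d ≠ 0 ∧ ∀ e, x e ≠ 0} := by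
    simp only [Set.ofPred_and, Set.ofPred_forall]
    exact (isOpen_ne_fun (MvPolynomial.continuous_eval d) continuous_const).inter
      (isOpen_iInter_of_finite fun e => isOpen_ne_fun (continuous_apply e) continuous_const)
  obtain ⟨x₁, hx₁, hne, heq⟩ := MvPolynomial.exists_ne_forall_eval_div_eval_eq v x₀ hx₀.1.1 _ hopen
    ⟨hx₀.1.2, hx₀.2⟩ fun x hx => hx.1
  rw [NetId.IsModelSet, Set.ext_iff] at hG
  obtain ⟨θ₀, hθ₀⟩ := (hG _).2 (NetId.isNetwork_map_C_eval E x₀ hx₀.2 hx₀.1.2)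
  obtain ⟨θ₁, hθ₁⟩ := (hG _).2 (NetId.isNetwork_map_C_eval E x₁ hx₁.2 hx₁.1)
  have hGeq : G θ₁ = G θ₀ := by
    refine hid θ₀ θ₁ (Matrix.ext fun l k => ?_)
    have hmem := hconst (NetId.symT_mem_adjoin_of_isOutput hF l.2 k.2)
    rw [NetId.symT, NetId.transfer_map_apply] at hmem
    -- The entry is an adjugate entry over `d` and is killed by the derivation, hence takes equal
    -- values at `x₀` and `x₁`.
    have := heq _ (Derivation.mul_eq_mul_of_mem_fractionConstants _ hd0 hmem)
    simp only [NetId.sub, Matrix.submatrix_apply]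
    rw [hθ₀, hθ₁, NetId.transfer_map_apply, NetId.transfer_map_apply]
    simp only [RingHom.comp_apply]
    rw [← hd, ← map_div₀ RatFunc.C, ← map_div₀ RatFunc.C, this]
  -- Equal network matrices have equal constants on every edge, which forces `x₁ = x₀`.
  refine hne (funext fun e => ?_)
  have := congrFun (congrFun hGeq e.1.2) e.1.1
  rw [hθ₀, hθ₁] at this
  exact RatFunc.C_injective (by simpa [NetId.polyG] using this)
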